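/- Let $a,b,c$ also denote the three generators of the Hanoi Towers group $H^{(3)}$, that is, the automorphisms of the rooted ternary tree (vertices: finite words over $\{0,1,2\}$) with self-similar form $$a=(01)(\mathrm{id},\mathrm{id},a),\qquad b=(02)(\mathrm{id},b,\mathrm{id}),\qquad c=(12)(c,\mathrm{id},\mathrm{id}),$$ where $g=\alpha(g_0,g_1,g_2)$ means $g(xw)=\alpha(x)\,g_x(w)$ for each letter $x$ and word $w$. For $n\ge 1$ let $\Sigma_n$ be the Schreier graph of the action on words of length $n$, without its loops: two distinct words $u,v$ of length $n$ are adjacent if and only if $s(u)=v$ for some $s\in\{a,b,c\}$; this $s$ is unique and is the label of the edge. Give each edge with label $a$, $b$, $c$ the weight $a$, $b$, $c$ respectively, where the weights are indeterminates (or elements of any commutative ring, e.g. positive reals). The weight of a spanning subgraph is the product of the weights of its edges, and a weighted generating function is the sum of the weights over all spanning subgraphs of the given kind. Call $0^n$, $1^n$, $2^n$ the leftmost, upmost and rightmost vertex of $\Sigma_n$. Let - $T_n$ be the weighted generating function of the spanning trees of $\Sigma_n$; - $U_n$ (respectively $R_n$, $L_n$) that of the spanning forests of $\Sigma_n$ with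 exactly two components in which the upmost (respectively rightmost, leftmost) vertex lies in one component and the two other outmost vertices both lie in the other component; - $Q_n$ that of the spanning forests of $\Sigma_n$ with exactly three components in which the three outmost vertices lie in three different components. Then for every $n\ge 1$: $$T_{n+1}=T_n^3(ab+ac+bc)+2abc\,T_n^2(U_n+R_n+L_n),$$ $$U_{n+1}=bT_n^3+T_n^2\big((ab+ac+bc)U_n+2b(aR_n+cL_n)\big)+abc\,T_n\big(3R_nL_n+U_n(L_n+R_n+2U_n)\big)+abc\,T_n^2Q_n,$$ $$R_{n+1}=aT_n^3+T_n^2\big((ab+ac+bc)R_n+2a(bU_n+cL_n)\big)+abc\,T_n\big(3U_nL_n+R_n(L_n+U_n+2R_n)\big)+abc\,T_n^2Q_n,$$ $$L_{n+1}=cT_n^3+T_n^2\big((ab+ac+bc)L_n+2c(aR_n+bU_n)\big)+abc\,T_n\big(3R_nU_n+L_n(U_n+R_n+2L_n)\big)+abc\,T_n^2Q_n,$$ $$\begin{aligned}Q_{n+1}={}&4abc\,T_nQ_n(U_n+R_n+L_n)+T_n^2\big((2b+a+c)U_n+(2a+b+c)R_n+(2c+a+b)L_n\big)\\&+T_n^2Q_n(ab+ac+bc)+T_n^3\\&+2abc\big(U_n^2(R_n+L_n)+R_n^2(U_n+L_n)+L_n^2(U_n+R_n)+U_nR_nL_n\big)\\&+2T_n\big(U_nR_n(ac+bc+2ab)+U_nL_n(ab+ac+2bc)+R_nL_n(ab+bc+2ac)\\&\qquad\quad+bU_n^2(a+c)+aR_n^2(b+c)+cL_n^2(a+b)\big),\end{aligned}$$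 and the initial values are $$T_1=ab+ac+bc,\qquad U_1=b,\qquad R_1=a,\qquad L_1=c,\qquad Q_1=1.$$ -/

import Mathlib

namespace Hanoi

/-- The three generators of the Hanoi Towers group on the ternary rooted tree. -/
inductive Gen where
  | a | b | c
  deriving DecidableEq

instance : Fintype Gen where
  elems := {.a, .b, .c}
  complete := by intro s; cases s <;> decide

/-- Words of length `n` over `{0,1,2}`, i.e. the vertices of the `n`-th level of the tree. -/
abbrev Word (n : ℕ) : Type := Fin n → Fin 3

/-- The permutation of the first level induced by a generator:
`(01)` for `a`, `(02)` for `b`, `(12)` for `c`. -/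
def rootPerm : Gen → Equiv.Perm (Fin 3)
  | .a => Equiv.swap 0 1
  | .b => Equiv.swap 0 2
  | .c => Equiv.swap 1 2

/-- The only letter at which the restriction of a generator is the generator itself
(at the two other letters the restriction is the identity). -/
def fixedLetter : Gen → Fin 3
  | .a => 2
  | .b => 1
  | .c => 0

/-- The action of the generators on the `n`-th level, given by the self-similar form
`a = (01)(id,id,a)`, `b = (02)(id,b,id)`, `c = (12)(c,id,id)`; here
`g = α(g₀,g₁,g₂)` acts by `g(xw) = α(x) g_x(w)`. -/
def act (s : Gen) : (n : ℕ) → Word n → Word n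
  | 0, w => w
  | n + 1, w =>
      Fin.cons (rootPerm s (w 0))
        (if w 0 = fixedLetter s then act s n (Fin.tail w) else Fin.tail w)

/-- The generators are involutions. -/
theorem act_act (s : Gen) (n : ℕ) (w : Word n) : act s n (act s n w) = w := by
  induction n with
  | zero => rfl
  | succ n ih =>
    have h1 : ∀ x, rootPerm s (rootPerm s x) = x := by cases s <;> decide
    have h2 : ∀ x, rootPerm s x = fixedLetter s ↔ x = fixedLetter s := by cases s <;> decide
    conv_rhs => rw [← Fin.cons_self_tail w]
    simp only [act, Fin.cons_zero, Fin.tail_cons, h1, h2]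
    split_ifs with h
    · rw [ih]
    · rfl

/-- A vertex moved by two generators to the same place is moved by the same generator:
the Schreier graphs have no multiple edges and the label of a non-loop edge is unique. -/
theorem label_unique (s t : Gen) (n : ℕ) (w : Word n) (hs : act s n w ≠ w)
    (h : act s n w = act t n w) : s = t := by
  induction n with
  | zero => exact absurd rfl hs
  | succ n ih =>
    have h0 : rootPerm s (w 0) = rootPerm t (w 0) := by simpa [act] using congrFun h 0
    by_cases hx : w 0 = fixedLetter s
    · have key : ∀ s t : Gen, rootPerm s (fixedLetter s) = rootPerm t (fixedLetter s) →
          s = t := by decide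
      exact key s t (by rw [← hx]; exact h0)
    · have key : ∀ (s t : Gen) (x : Fin 3), x ≠ fixedLetter s →
          rootPerm s x = rootPerm t x → s = t := by decide
      exact key s t _ hx h0

/-- The `n`-th Schreier graph `Σ_n` of the Hanoi Towers group with respect to the generators
`a, b, c`, without its loops: distinct words `u`, `v` of length `n` are adjacent if and only if
some generator maps `u` to `v`. -/
def schreierGraph (n : ℕ) : SimpleGraph (Word n) where
  Adj u v := u ≠ v ∧ ∃ s : Gen, act s n u = v
  symm := ⟨by
    rintro u v ⟨huv, s, rfl⟩
    exact ⟨huv.symm, s, act_act s n u⟩⟩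
  loopless := ⟨fun _ h => h.1 rfl⟩

/-- The weight attached to a label. -/
def labelWeight {K : Type*} (a b c : K) : Gen → K
  | .a => a
  | .b => b
  | .c => c

open Classical in
/-- The weight of an edge of `Σ_n`: the sum of the weights of the generators that label it.
There is exactly one such label, see `edgeWeight_eq`. -/
noncomputable def edgeWeight {K : Type*} [CommRing K] (a b c : K) (n : ℕ)
    (e : Sym2 (Word n)) : K :=
  ∑ s : Gen with ∃ u : Word n, e = s(u, act s n u), labelWeight a b c s

/-- The edge of `Σ_n` joining `u` to `s(u)`, which is labelled by `s`, has the weight of `s`. -/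
theorem edgeWeight_eq {K : Type*} [CommRing K] (a b c : K) (n : ℕ) (s : Gen) (u : Word n)
    (hs : act s n u ≠ u) :
    edgeWeight a b c n s(u, act s n u) = labelWeight a b c s := by
  classical
  have : (Finset.univ.filter fun t : Gen =>
      ∃ v : Word n, s(u, act s n u) = s(v, act t n v)) = {s} := by
    ext t
    simp only [Finset.mem_filter, Finset.mem_univ, true_and, Finset.mem_singleton]
    constructor
    · rintro ⟨v, hv⟩
      rcases Sym2.eq_iff.1 hv with ⟨h1, h2⟩ | ⟨h1, h2⟩
      · subst h1; exact (label_unique s t n u hs h2).symm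
      · subst h2
        refine (label_unique s t n u hs ?_).symm
        conv_rhs => rw [h1]
        rw [act_act]
    · rintro rfl; exact ⟨u, rfl⟩
  unfold edgeWeight
  rw [← Finset.sum_singleton (labelWeight a b c) s, ← this]

open Classical in
/-- The weighted generating function of the spanning subgraphs `H` of `G` with property `P`:
the sum over all such `H` of the product of the weights of the edges of `H`. A spanning subgraph
of `G` is a graph on the vertex set of `G` all of whose edges are edges of `G`. -/
noncomputable def genFun {V K : Type*} [Fintype V] [CommRing K] (G : SimpleGraph V)
    (w : Sym2 V → K) (P : SimpleGraph V → Prop) : K :=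
  ∑ H : SimpleGraph V with H ≤ G ∧ P H, ∏ e ∈ H.edgeFinset, w e

/-- A `k`-forest: a forest with exactly `k` connected components. -/
def IsForest {V : Type*} (k : ℕ) (H : SimpleGraph V) : Prop :=
  H.IsAcyclic ∧ Nat.card H.ConnectedComponent = k

/-- The leftmost outmost vertex `0ⁿ` of `Σ_n`. -/
def left (n : ℕ) : Word n := fun _ => 0

/-- The upmost outmost vertex `1ⁿ` of `Σ_n`. -/
def up (n : ℕ) : Word n := fun _ => 1

/-- The rightmost outmost vertex `2ⁿ` of `Σ_n`. -/
def right (n : ℕ) : Word n := fun _ => 2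

section GeneratingFunctions

variable {K : Type*} [CommRing K] (a b c : K) (n : ℕ)

/-- `T_n(a,b,c)`: spanning trees of `Σ_n`. -/
noncomputable def genT : K :=
  genFun (schreierGraph n) (edgeWeight a b c n) fun H => H.IsTree

/-- `U_n(a,b,c)`: spanning 2-forests of `Σ_n` with the leftmost and rightmost vertices in the same
component and the upmost vertex in the other component. -/
noncomputable def genU : K :=
  genFun (schreierGraph n) (edgeWeight a b c n) fun H =>
    IsForest 2 H ∧ H.Reachable (left n) (right n) ∧ ¬ H.Reachable (left n) (up n)

/-- `R_n(a,b,c)`: spanning 2-forests of `Σ_n` with the leftmost and upmost vertices in the same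
component and the rightmost vertex in the other component. -/
noncomputable def genR : K :=
  genFun (schreierGraph n) (edgeWeight a b c n) fun H =>
    IsForest 2 H ∧ H.Reachable (left n) (up n) ∧ ¬ H.Reachable (left n) (right n)

/-- `L_n(a,b,c)`: spanning 2-forests of `Σ_n` with the upmost and rightmost vertices in the same
component and the leftmost vertex in the other component. -/
noncomputable def genL : K :=
  genFun (schreierGraph n) (edgeWeight a b c n) fun H =>
    IsForest 2 H ∧ H.Reachable (up n) (right n) ∧ ¬ H.Reachable (up n) (left n)

/-- `Q_n(a,b,c)`: spanning 3-forests of `Σ_n` with the three outmost vertices in three different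
components. -/
noncomputable def genQ : K :=
  genFun (schreierGraph n) (edgeWeight a b c n) fun H =>
    IsForest 3 H ∧ ¬ H.Reachable (left n) (up n) ∧ ¬ H.Reachable (left n) (right n) ∧
      ¬ H.Reachable (up n) (right n)

end GeneratingFunctions

end Hanoi

/-! A generator `s` alters the last letter of a word only if all earlier letters equal `fixedLetter
s`. Grouping words by their last letter therefore splits `Σ_{n+1}` into three copies of `Σ_n` and
three further edges, one for each label, joining outmost vertices of different copies
(`schreierGraph_succ`).

Each of T, U, R, L, Q counts forests in which every component meets an outmost vertex, and the five
differ only in the partition induced on these three vertices (`IsRooted`, `Pattern`). Paths leave a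
copy only through its outmost vertices, so such a forest on `Σ_{n+1}` restricts to one of the five
patterns on each copy. Conversely, the three patterns and the set of bridges used decide whether the
union is a forest and which pattern it has (`isRooted_addEdges_iff`). The generating function is
thus a sum over 8 sets of bridges and 125 triples of patterns (`genPattern_succ`), and the
admissible triples are found by a finite computation.

The recursion already holds from level 0, a single vertex, and this yields the initial values. -/

namespace Hanoi

open SimpleGraph

/-! ### Forests with terminals, and the effect of joining terminals by edges. -/

section Rooted

variable {V ι κ A B : Type*}

/-- `H` is a forest each of whose components contains one of the vertices `t j`, and
`g` labels the vertices `t j` by the components that contain them. -/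
def IsRooted (t : ι → V) (g : ι → A) (H : SimpleGraph V) : Prop :=
  H.IsAcyclic ∧ (∀ v, ∃ j, H.Reachable v (t j)) ∧ ∀ j k, H.Reachable (t j) (t k) ↔ g j = g k

/-- A walk that crosses the new edge repeatedly can be shortened to cross it at most once. -/
theorem reachable_sup_edge {H : SimpleGraph V} {p q u v : V} :
    (H ⊔ edge p q).Reachable u v ↔ H.Reachable u v ∨ (H.Reachable u p ∧ H.Reachable q v) ∨
      (H.Reachable u q ∧ H.Reachable p v) := by
  constructor
  · rintro ⟨w⟩
    induction w with
    | nil => exact Or.inl (Reachable.refl _)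
    | @cons x y z hxy _ ih =>
      rw [sup_adj, edge_adj] at hxy
      rcases hxy with hxy | ⟨⟨rfl, rfl⟩ | ⟨rfl, rfl⟩, -⟩
      · have h := hxy.reachable
        rcases ih with h1 | ⟨h1, h2⟩ | ⟨h1, h2⟩
        · exact Or.inl (h.trans h1)
        · exact Or.inr (Or.inl ⟨h.trans h1, h2⟩)
        · exact Or.inr (Or.inr ⟨h.trans h1, h2⟩)
      · rcases ih with h1 | ⟨h1, h2⟩ | ⟨h1, h2⟩
        · exact Or.inr (Or.inl ⟨Reachable.refl _, h1⟩)
        · exact Or.inr (Or.inl ⟨Reachable.refl _, h2⟩)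
        · exact Or.inl h2
      · rcases ih with h1 | ⟨h1, h2⟩ | ⟨h1, h2⟩
        · exact Or.inr (Or.inr ⟨Reachable.refl _, h1⟩)
        · exact Or.inl h2
        · exact Or.inr (Or.inr ⟨Reachable.refl _, h2⟩)
  · have mono : ∀ {x y}, H.Reachable x y → (H ⊔ edge p q).Reachable x y :=
      fun h => h.mono le_sup_left
    have hpq : (H ⊔ edge p q).Reachable p q := by
      by_cases h : p = q
      · rw [h]
      · exact Adj.reachable (Or.inr (by simp [edge_adj, h]))
    rintro (h | ⟨h1, h2⟩ | ⟨h1, h2⟩)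
    · exact mono h
    · exact (mono h1).trans (hpq.trans (mono h2))
    · exact (mono h1).trans (hpq.symm.trans (mono h2))

/-- Add to `H` the edges joining the listed pairs of terminals. -/
def addEdges (t : ι → V) : SimpleGraph V → List (ι × ι) → SimpleGraph V
  | H, [] => H
  | H, x :: l => addEdges t (H ⊔ edge (t x.1) (t x.2)) l

theorem le_addEdges (t : ι → V) (l : List (ι × ι)) : ∀ H, H ≤ addEdges t H l := by
  induction l with
  | nil => exact fun H => le_rfl
  | cons x l ih => exact fun H => le_sup_left.trans (ih _)

/-- Added edges have terminals at both ends, so a walk follows `H` until it first meets one of them,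
hence up to a terminal. -/
theorem exists_reachable_of_addEdges (t : ι → V) (l : List (ι × ι)) :
    ∀ (H : SimpleGraph V) (v : V), (∃ j, (addEdges t H l).Reachable v (t j)) →
      ∃ j, H.Reachable v (t j) := by
  induction l with
  | nil => exact fun H v h => h
  | cons x l ih =>
    intro H v h
    obtain ⟨j, hj⟩ := ih _ v h
    rcases reachable_sup_edge.1 hj with h | ⟨h, -⟩ | ⟨h, -⟩
    exacts [⟨_, h⟩, ⟨_, h⟩, ⟨_, h⟩]

/-- Identify the labels of `p` and `q`. -/
def merge [DecidableEq A] (g : ι → A) (p q : ι) : ι → A :=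
  fun x => if g x = g p then g q else g x

/-- An edge between two different components closes no cycle and unites just these two. -/
theorem IsRooted.sup_edge [DecidableEq A] {t : ι → V} {g : ι → A} {H : SimpleGraph V}
    (h : IsRooted t g H) {p q : ι} (hpq : g p ≠ g q) :
    IsRooted t (merge g p q) (H ⊔ edge (t p) (t q)) := by
  obtain ⟨h1, h2, h3⟩ := h
  refine ⟨h1.sup_edge_of_not_reachable (by rwa [h3]), fun v => ?_, fun j k => ?_⟩
  · obtain ⟨j, hj⟩ := h2 v
    exact ⟨j, hj.mono le_sup_left⟩
  · rw [reachable_sup_edge]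
    simp only [h3, merge]
    grind

/-- In a forest the new edge would be a bridge, but its ends are already connected in `H`. -/
theorem IsRooted.not_isAcyclic_sup_edge {t : ι → V} {g : ι → A} {H : SimpleGraph V}
    (h : IsRooted t g H) {p q : ι} (hpq : g p = g q) (hne : t p ≠ t q)
    (hadj : ¬ H.Adj (t p) (t q)) : ¬ (H ⊔ edge (t p) (t q)).IsAcyclic := by
  intro hac
  have := isAcyclic_iff_forall_isBridge.1 hac (e := s(t p, t q))
    (by simp [hne])
  rw [isBridge_sup_edge, isBridge_iff] at this
  refine this ?_
  have hd : H \ fromEdgeSet {s(t p, t q)} = H := sdiff_edge H hadj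
  rw [deleteEdges, hd]
  exact (h.2.2 p q).2 hpq

/-- Whether joining the listed pairs creates no cycle, starting from the labels `g`, and, if so,
the resulting labels, restricted to `out`, still label all components and agree with `h`. -/
def Outcome [DecidableEq A] (out : κ → ι) (h : κ → B) : (ι → A) → List (ι × ι) → Prop
  | g, [] => (∀ x, ∃ k, g x = g (out k)) ∧ ∀ j k, g (out j) = g (out k) ↔ h j = h k
  | g, x :: l => g x.1 ≠ g x.2 ∧ Outcome out h (merge g x.1 x.2) l

instance [DecidableEq A] [DecidableEq B] [Fintype ι] [Fintype κ] (out : κ → ι) (h : κ → B) :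
    ∀ (g : ι → A) (l : List (ι × ι)), Decidable (Outcome out h g l)
  | g, [] => inferInstanceAs
      (Decidable ((∀ x, ∃ k, g x = g (out k)) ∧ ∀ j k, g (out j) = g (out k) ↔ h j = h k))
  | g, x :: l =>
    have := instDecidableOutcomeOfDecidableEqOfFintype out h (merge g x.1 x.2) l
    inferInstanceAs (Decidable (g x.1 ≠ g x.2 ∧ Outcome out h (merge g x.1 x.2) l))

/-- Here `out` selects the terminals that survive. Every component contains an old terminal, so the
labels alone tell whether the survivors still reach everything. -/
theorem isRooted_comp_iff {t : ι → V} {g : ι → A} {H : SimpleGraph V} (hH : IsRooted t g H)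
    (out : κ → ι) (h : κ → B) :
    IsRooted (t ∘ out) h H ↔
      (∀ x, ∃ k, g x = g (out k)) ∧ ∀ j k, g (out j) = g (out k) ↔ h j = h k := by
  obtain ⟨h1, h2, h3⟩ := hH
  simp only [IsRooted, Function.comp, h3, h1, true_and]
  refine and_congr_left fun _ => ⟨fun hc x => ?_, fun hc v => ?_⟩
  · obtain ⟨k, hk⟩ := hc (t x)
    exact ⟨k, (h3 _ _).1 hk⟩
  · obtain ⟨x, hx⟩ := h2 v
    obtain ⟨k, hk⟩ := hc x
    exact ⟨k, hx.trans ((h3 _ _).2 hk)⟩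

/-- This reduces a question on graphs to a decidable one on labels. The edges must be new and
pairwise distinct: adding an edge twice changes nothing, whereas `Outcome` would report a cycle. -/
theorem isRooted_addEdges_iff [DecidableEq A] {t : ι → V} (out : κ → ι) (h : κ → B)
    (l : List (ι × ι)) :
    ∀ {g : ι → A} {H : SimpleGraph V}, IsRooted t g H → (∀ x ∈ l, t x.1 ≠ t x.2) →
      (∀ x ∈ l, ¬ H.Adj (t x.1) (t x.2)) →
      l.Pairwise (fun x y => s(t x.1, t x.2) ≠ s(t y.1, t y.2)) →
      (IsRooted (t ∘ out) h (addEdges t H l) ↔ Outcome out h g l) := by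
  induction l with
  | nil => exact fun hH _ _ _ => isRooted_comp_iff hH out h
  | cons x l ih =>
    intro g H hH hne hadj hp
    simp only [addEdges, Outcome]
    rw [List.pairwise_cons] at hp
    by_cases hx : g x.1 = g x.2
    · simp only [hx, ne_eq, not_true_eq_false, false_and, iff_false]
      intro hr
      -- A cycle, once closed, survives the addition of the remaining edges.
      exact hH.not_isAcyclic_sup_edge hx (hne x (by simp)) (hadj x (by simp))
        (hr.1.anti (le_addEdges t l _))
    · simp only [ne_eq, hx, not_false_eq_true, true_and]
      refine ih (hH.sup_edge hx) (fun y hy => hne y (by simp [hy])) (fun y hy => ?_) hp.2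
      rw [sup_adj, adj_edge]
      exact not_or.2 ⟨hadj y (by simp [hy]), fun h => hp.1 y hy h.1⟩

end Rooted

/-! ### Disjoint unions of graphs. -/

section Copies

variable {V W ι κ A : Type*}

/-- The disjoint union of a family of graphs on `W`, transported along `e`. -/
def copies (e : ι × W ≃ V) (H : ι → SimpleGraph W) : SimpleGraph V where
  Adj x y := (e.symm x).1 = (e.symm y).1 ∧ (H (e.symm x).1).Adj (e.symm x).2 (e.symm y).2
  symm := ⟨fun _ _ h => ⟨h.1.symm, h.1 ▸ h.2.symm⟩⟩
  loopless := ⟨fun _ h => h.2.ne rfl⟩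

@[simp]
theorem copies_adj {e : ι × W ≃ V} {H : ι → SimpleGraph W} {i j : ι} {u v : W} :
    (copies e H).Adj (e (i, u)) (e (j, v)) ↔ i = j ∧ (H i).Adj u v := by
  simp [copies]

/-- The inclusion of a graph in a disjoint union. -/
def copiesHom (e : ι × W ≃ V) (H : ι → SimpleGraph W) (i : ι) : H i →g copies e H where
  toFun v := e (i, v)
  map_rel' h := copies_adj.2 ⟨rfl, h⟩

theorem copies_reachable {e : ι × W ≃ V} {H : ι → SimpleGraph W} {i j : ι} {u v : W} :
    (copies e H).Reachable (e (i, u)) (e (j, v)) ↔ i = j ∧ (H i).Reachable u v := by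
  constructor
  · have key : ∀ x y, (copies e H).Reachable x y →
        (e.symm x).1 = (e.symm y).1 ∧
          (H (e.symm x).1).Reachable (e.symm x).2 (e.symm y).2 := by
      rintro x y ⟨w⟩
      induction w with
      | nil => exact ⟨rfl, Reachable.refl _⟩
      | cons h _ ih => exact ⟨h.1.trans ih.1, h.2.reachable.trans (h.1 ▸ ih.2)⟩
    intro h
    simpa using key _ _ h
  · rintro ⟨rfl, h⟩
    exact h.map (copiesHom e H i)

theorem copies_isAcyclic {e : ι × W ≃ V} {H : ι → SimpleGraph W} :
    (copies e H).IsAcyclic ↔ ∀ i, (H i).IsAcyclic := by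
  constructor
  · intro h i
    exact h.comap (copiesHom e H i) fun u v huv => by simpa [copiesHom] using huv
  · intro h
    rw [isAcyclic_iff_forall_adj_isBridge]
    intro x y hxy
    obtain ⟨⟨i, u⟩, rfl⟩ := e.surjective x
    obtain ⟨⟨j, v⟩, rfl⟩ := e.surjective y
    obtain ⟨rfl, huv⟩ := copies_adj.1 hxy
    have hb := isAcyclic_iff_forall_adj_isBridge.1 (h i) huv
    rw [isBridge_iff] at hb ⊢
    intro hr
    apply hb
    classical
    -- Deleting an edge of the part `i` affects that part only, so a detour around it would already
    -- exist inside `H i`.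
    have : (copies e H).deleteEdges {s(e (i, u), e (i, v))} ≤
        copies e (Function.update H i ((H i).deleteEdges {s(u, v)})) := by
      intro x y hxy
      obtain ⟨⟨j, u'⟩, rfl⟩ := e.surjective x
      obtain ⟨⟨k, v'⟩, rfl⟩ := e.surjective y
      rw [deleteEdges_adj, copies_adj] at hxy
      obtain ⟨⟨rfl, h1⟩, h2⟩ := hxy
      refine copies_adj.2 ⟨rfl, ?_⟩
      by_cases hj : j = i
      · subst hj
        simp only [Function.update_self, deleteEdges_adj]
        refine ⟨h1, ?_⟩
        simpa using h2
      · simpa [hj] using h1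
    have := (copies_reachable.1 (hr.mono this)).2
    simpa using this

theorem IsRooted.copies {e : ι × W ≃ V} {H : ι → SimpleGraph W} {t : κ → W} {g : ι → κ → A}
    (h : ∀ i, IsRooted t (g i) (H i)) :
    IsRooted (fun x : ι × κ => e (x.1, t x.2)) (fun x => (x.1, g x.1 x.2)) (copies e H) := by
  refine ⟨copies_isAcyclic.2 fun i => (h i).1, fun v => ?_, ?_⟩
  · obtain ⟨⟨i, u⟩, rfl⟩ := e.surjective v
    obtain ⟨j, hj⟩ := (h i).2.1 u
    exact ⟨(i, j), copies_reachable.2 ⟨rfl, hj⟩⟩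
  · rintro ⟨i, j⟩ ⟨i', k⟩
    rw [copies_reachable]
    simp only [Prod.mk.injEq]
    refine and_congr_right ?_
    rintro rfl
    exact (h i).2.2 j k

/-- The restriction step: a component of a part without a terminal could not be reached by any
joining edge. -/
theorem isAcyclic_and_rooted_of_copies {e : ι × W ≃ V} {H : ι → SimpleGraph W} {t : κ → W}
    {l : List ((ι × κ) × (ι × κ))} {μ B : Type*} {out : μ → ι × κ} {h : μ → B}
    (hH : IsRooted ((fun x : ι × κ => e (x.1, t x.2)) ∘ out) h
      (addEdges (fun x : ι × κ => e (x.1, t x.2)) (copies e H) l)) (i : ι) :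
    (H i).IsAcyclic ∧ ∀ v, ∃ j, (H i).Reachable v (t j) := by
  refine ⟨copies_isAcyclic.1 (hH.1.anti (le_addEdges _ l _)) i, fun v => ?_⟩
  obtain ⟨j, hj⟩ := hH.2.1 (e (i, v))
  obtain ⟨⟨i', k⟩, hk⟩ := exists_reachable_of_addEdges _ l _ _ ⟨_, hj⟩
  obtain ⟨rfl, hk⟩ := copies_reachable.1 hk
  exact ⟨k, hk⟩

end Copies

/-! ### Generating functions under adding an edge and under disjoint union. -/

section GenFun

variable {V W ι K : Type*} [CommRing K]

open Classical in
theorem genFun_congr [Fintype V] {G : SimpleGraph V} {w w' : Sym2 V → K}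
    {P P' : SimpleGraph V → Prop} (hw : ∀ x ∈ G.edgeSet, w x = w' x)
    (hP : ∀ H ≤ G, P H ↔ P' H) : genFun G w P = genFun G w' P' := by
  unfold genFun
  refine Finset.sum_congr ?_ fun H hH => Finset.prod_congr rfl fun x hx => hw x ?_
  · ext H
    simp only [Finset.mem_filter, Finset.mem_univ, true_and]
    exact and_congr_right (hP H)
  · simp only [Finset.mem_filter, Finset.mem_univ, true_and] at hH
    exact edgeSet_mono hH.1 (mem_edgeFinset.1 hx)

open Classical in
/-- Sort the spanning subgraphs by whether they contain a given edge. -/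
theorem genFun_sup_edge [Fintype V] {G : SimpleGraph V} (w : Sym2 V → K)
    (P : SimpleGraph V → Prop) {p q : V} (hpq : p ≠ q) (hG : ¬ G.Adj p q) :
    genFun (G ⊔ edge p q) w P =
      genFun G w P + w s(p, q) * genFun G w fun H => P (H ⊔ edge p q) := by
  unfold genFun
  rw [← Finset.sum_filter_not_add_sum_filter _ (fun H : SimpleGraph V => H.Adj p q)]
  congr 1
  · refine Finset.sum_congr ?_ fun _ _ => rfl
    ext H
    simp only [Finset.mem_filter, Finset.mem_univ, true_and]
    constructor
    · rintro ⟨⟨h1, h2⟩, h3⟩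
      refine ⟨?_, h2⟩
      intro x y hxy
      rcases h1 hxy with h | h
      · exact h
      · rw [edge_adj] at h
        rcases h.1 with ⟨rfl, rfl⟩ | ⟨rfl, rfl⟩
        exacts [absurd hxy h3, absurd hxy.symm h3]
    · rintro ⟨h1, h2⟩
      exact ⟨⟨h1.trans le_sup_left, h2⟩, fun h => hG (h1 h)⟩
  · rw [Finset.mul_sum]
    -- Deleting and adding the edge are inverse bijections between the subgraphs that contain it and
    -- the subgraphs of `G`.
    have hback : ∀ H : SimpleGraph V, H.Adj p q → H \ edge p q ⊔ edge p q = H := by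
      intro H h
      exact sdiff_sup_cancel (by simpa [edge_le, hpq] using h)
    have hforth : ∀ H : SimpleGraph V, H ≤ G → (H ⊔ edge p q) \ edge p q = H := by
      intro H h
      rw [sup_sdiff_right_self]
      exact sdiff_edge H fun h' => hG (h h')
    refine Finset.sum_nbij' (fun H => H \ edge p q) (fun H => H ⊔ edge p q) ?_ ?_ ?_ ?_ ?_
    · intro H hH
      simp only [Finset.mem_filter, Finset.mem_univ, true_and] at hH ⊢
      refine ⟨?_, ?_⟩
      · rw [sdiff_le_iff, sup_comm]
        exact hH.1.1
      · rw [hback H hH.2]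
        exact hH.1.2
    · intro H hH
      simp only [Finset.mem_filter, Finset.mem_univ, true_and] at hH ⊢
      refine ⟨⟨sup_le_sup_right hH.1 _, hH.2⟩, ?_⟩
      exact Or.inr (by simp [edge_adj, hpq])
    · intro H hH
      simp only [Finset.mem_filter, Finset.mem_univ, true_and] at hH
      exact hback H hH.2
    · intro H hH
      simp only [Finset.mem_filter, Finset.mem_univ, true_and] at hH
      exact hforth H hH.1
    · intro H hH
      simp only [Finset.mem_filter, Finset.mem_univ, true_and] at hH
      have hn : ¬ (H \ edge p q).Adj p q := fun h => h.2 (by simp [edge_adj, hpq])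
      have hE : H.edgeFinset = insert s(p, q) (H \ edge p q).edgeFinset := by
        ext x
        induction x with
        | h x y =>
          have := hH.2
          have := hH.2.symm
          simp only [mem_edgeFinset, mem_edgeSet, Finset.mem_insert, sdiff_adj, edge_adj,
            Sym2.eq_iff]
          grind [Adj.ne]
      rw [hE, Finset.prod_insert (by rwa [mem_edgeFinset, mem_edgeSet])]
      congr!

theorem copies_le {e : ι × W ≃ V} {H G : ι → SimpleGraph W} :
    copies e H ≤ copies e G ↔ ∀ i, H i ≤ G i := by
  constructor
  · intro h i u v huv
    exact (copies_adj.1 (h (copies_adj.2 ⟨rfl, huv⟩ : (copies e H).Adj (e (i, u)) (e (i, v))))).2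
  · exact fun h x y hxy => ⟨hxy.1, h _ hxy.2⟩

theorem copies_comap {e : ι × W ≃ V} {G : ι → SimpleGraph W} {H : SimpleGraph V}
    (hH : H ≤ copies e G) : copies e (fun i => H.comap fun v => e (i, v)) = H := by
  ext x y
  obtain ⟨⟨i, u⟩, rfl⟩ := e.surjective x
  obtain ⟨⟨j, v⟩, rfl⟩ := e.surjective y
  rw [copies_adj]
  constructor
  · rintro ⟨rfl, h⟩
    exact h
  · intro h
    obtain ⟨rfl, -⟩ := copies_adj.1 (hH h)
    exact ⟨rfl, h⟩

theorem comap_copies {e : ι × W ≃ V} {H : ι → SimpleGraph W} (i : ι) :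
    (copies e H).comap (fun v => e (i, v)) = H i := by
  ext u v
  simp

open Classical in
theorem prod_edgeFinset_copies [Fintype ι] [Fintype V] [Fintype W] (e : ι × W ≃ V)
    (H : ι → SimpleGraph W) (w : Sym2 V → K) :
    ∏ x ∈ (copies e H).edgeFinset, w x =
      ∏ i, ∏ x ∈ (H i).edgeFinset, w (x.map fun v => e (i, v)) := by
  rw [Finset.prod_sigma']
  symm
  refine Finset.prod_bij (fun x _ => x.2.map fun v => e (x.1, v)) ?_ ?_ ?_ fun _ _ => rfl
  · rintro ⟨i, x⟩ hx
    induction x with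
    | h u v => simpa using hx
  · rintro ⟨i, x⟩ hx ⟨j, y⟩ hy h
    induction x with
    | h u v =>
      induction y with
      | h u' v' =>
        simp only [Sym2.map_mk, Sym2.eq_iff, EmbeddingLike.apply_eq_iff_eq,
          Prod.mk.injEq] at h
        obtain rfl : i = j := by rcases h with h | h <;> exact h.1.1
        congr 1
        rw [Sym2.eq_iff]
        simpa using h
  · intro x hx
    induction x with
    | h x y =>
      obtain ⟨⟨i, u⟩, rfl⟩ := e.surjective x
      obtain ⟨⟨j, v⟩, rfl⟩ := e.surjective y
      rw [mem_edgeFinset, mem_edgeSet, copies_adj] at hx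
      obtain ⟨rfl, h⟩ := hx
      exact ⟨⟨i, s(u, v)⟩, by simpa using h, rfl⟩

open Classical in
/-- If membership of `copies e H` in a class is determined by the types of the parts `H i`, then
the generating function is a sum of products over the admissible families of types. -/
theorem genFun_copies {τ : Type*} [Fintype τ] [Fintype ι] [Fintype V] [Fintype W] (e : ι × W ≃ V)
    (G : SimpleGraph W) (w : Sym2 V → K) (w' : Sym2 W → K)
    (hw : ∀ i, ∀ x ∈ G.edgeSet, w (x.map fun v => e (i, v)) = w' x)
    (P : SimpleGraph V → Prop) (F : τ → SimpleGraph W → Prop) (O : (ι → τ) → Prop)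
    (hF : ∀ H p q, F p H → F q H → p = q)
    (hP : ∀ H : ι → SimpleGraph W, (∀ i, H i ≤ G) →
      (P (copies e H) ↔ ∃ p, O p ∧ ∀ i, F (p i) (H i))) :
    genFun (copies e fun _ => G) w P = ∑ p : ι → τ with O p, ∏ i, genFun G w' (F (p i)) := by
  unfold genFun
  -- Expanding the products gives sums over families of subgraphs; they merge into one sum because,
  -- by `hF`, a graph has at most one type.
  simp_rw [Finset.prod_univ_sum]
  rw [← Finset.sum_biUnion]
  · refine Finset.sum_nbij' (fun H i => H.comap fun v => e (i, v)) (copies e) ?_ ?_ ?_ ?_ ?_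
    · intro H hH
      simp only [Finset.mem_filter, Finset.mem_univ, true_and] at hH
      have h1 := copies_comap hH.1
      have h2 : ∀ i, H.comap (fun v => e (i, v)) ≤ G := by
        have := hH.1
        rw [← h1, copies_le] at this
        exact this
      have h3 := hH.2
      rw [← h1, hP _ h2] at h3
      obtain ⟨p, hp, hF⟩ := h3
      simp only [Finset.mem_biUnion, Finset.mem_filter, Finset.mem_univ, true_and,
        Fintype.mem_piFinset]
      exact ⟨p, hp, fun i => ⟨h2 i, hF i⟩⟩
    · intro H hH
      simp only [Finset.mem_biUnion, Finset.mem_filter, Finset.mem_univ, true_and,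
        Fintype.mem_piFinset] at hH ⊢
      obtain ⟨p, hp, hF⟩ := hH
      exact ⟨copies_le.2 fun i => (hF i).1, (hP H fun i => (hF i).1).2 ⟨p, hp, fun i => (hF i).2⟩⟩
    · intro H hH
      simp only [Finset.mem_filter, Finset.mem_univ, true_and] at hH
      exact copies_comap hH.1
    · intro H _
      exact funext fun i => comap_copies i
    · intro H hH
      simp only [Finset.mem_filter, Finset.mem_univ, true_and] at hH
      have h1 := copies_comap hH.1
      have h2 := hH.1
      rw [← h1, copies_le] at h2
      conv_lhs => rw [← h1]
      rw [prod_edgeFinset_copies]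
      refine Finset.prod_congr rfl fun i _ => Finset.prod_congr rfl fun x hx => hw i x ?_
      exact edgeSet_mono (h2 i) (mem_edgeFinset.1 hx)
  · intro p _ q _ hpq
    refine Finset.disjoint_left.2 fun H h1 h2 => hpq (funext fun i => ?_)
    simp only [Finset.mem_filter, Finset.mem_univ, true_and, Fintype.mem_piFinset] at h1 h2
    exact hF _ _ _ (h1 i).2 (h2 i).2

end GenFun

/-! ### The five connection patterns of the outmost vertices. -/

/-- The ways in which a spanning forest can connect the three outmost vertices. -/
inductive Pattern where
  | tree | up | right | left | sep
  deriving DecidableEq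

instance : Fintype Pattern where
  elems := {.tree, .up, .right, .left, .sep}
  complete := by intro p; cases p <;> decide

/-- Each outmost vertex is sent to the first one connected to it. -/
def Pattern.rep : Pattern → Fin 3 → Fin 3
  | .tree => ![0, 0, 0]
  | .up => ![0, 1, 0]
  | .right => ![0, 0, 2]
  | .left => ![0, 1, 1]
  | .sep => ![0, 1, 2]

/-- The outmost vertices. -/
def corner (n : ℕ) (j : Fin 3) : Word n := fun _ => j

section Types

variable {V ι A : Type*}

theorem forall_fin_three_iff {r : Fin 3 → Fin 3 → Prop} (hr : Equivalence r)
    (g : Fin 3 → A) : (∀ j k, r j k ↔ g j = g k) ↔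
      (r 0 1 ↔ g 0 = g 1) ∧ (r 0 2 ↔ g 0 = g 2) ∧ (r 1 2 ↔ g 1 = g 2) := by
  constructor
  · exact fun h => ⟨h _ _, h _ _, h _ _⟩
  · rintro ⟨h1, h2, h3⟩ j k
    have hs : ∀ {x y}, r x y ↔ r y x := ⟨hr.symm, hr.symm⟩
    fin_cases j <;> fin_cases k <;>
      first
      | exact iff_of_true (hr.refl _) rfl
      | assumption
      | (rw [hs, eq_comm]; assumption)

/-- Once the labels match the components of the terminals, the number of labels in use is the number
of components met by terminals; all components are met exactly when the two counts agree. -/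
theorem isRooted_iff_isForest [Finite V] {t : ι → V} {g : ι → A} {H : SimpleGraph V} :
    IsRooted t g H ↔
      IsForest (Nat.card (Set.range g)) H ∧ ∀ j k, H.Reachable (t j) (t k) ↔ g j = g k := by
  simp only [IsRooted, IsForest, and_assoc]
  refine and_congr_right fun _ => and_congr_left fun h => ?_
  set f : ι → H.ConnectedComponent := fun j => H.connectedComponentMk (t j) with hf
  have hker : Setoid.ker g = Setoid.ker f := by
    ext j k
    rw [Setoid.ker_def, Setoid.ker_def, ← h j k, hf, ConnectedComponent.eq]
  have hcard : Nat.card (Set.range g) = Nat.card (Set.range f) := by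
    rw [← Nat.card_congr (Setoid.quotientKerEquivRange g),
      ← Nat.card_congr (Setoid.quotientKerEquivRange f), hker]
  rw [hcard, Nat.card_coe_set_eq, eq_comm, ← Set.eq_univ_iff_ncard, Set.eq_univ_iff_forall]
  constructor
  · intro hc x
    induction x using ConnectedComponent.ind with
    | h v =>
      obtain ⟨j, hj⟩ := hc v
      exact ⟨j, ConnectedComponent.eq.2 hj.symm⟩
  · intro hc v
    obtain ⟨j, hj⟩ := hc (H.connectedComponentMk v)
    exact ⟨j, (ConnectedComponent.eq.1 hj).symm⟩

theorem isRooted_iff_isForest_fin_three [Finite V] {t : Fin 3 → V} {p : Pattern}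
    {H : SimpleGraph V} : IsRooted t p.rep H ↔
      IsForest (Fintype.card (Set.range p.rep)) H ∧
        (H.Reachable (t 0) (t 1) ↔ p.rep 0 = p.rep 1) ∧
        (H.Reachable (t 0) (t 2) ↔ p.rep 0 = p.rep 2) ∧
        (H.Reachable (t 1) (t 2) ↔ p.rep 1 = p.rep 2) := by
  rw [isRooted_iff_isForest, Nat.card_eq_fintype_card,
    forall_fin_three_iff (r := fun j k => H.Reachable (t j) (t k))
      ⟨fun _ => Reachable.refl _, Reachable.symm, Reachable.trans⟩]

theorem Pattern.eq_of_isRooted {t : Fin 3 → V} {H : SimpleGraph V} {p q : Pattern}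
    (hp : IsRooted t p.rep H) (hq : IsRooted t q.rep H) : p = q := by
  have key : ∀ p q : Pattern, (∀ j k, p.rep j = p.rep k ↔ q.rep j = q.rep k) → p = q := by
    decide
  exact key p q fun j k => (hp.2.2 j k).symm.trans (hq.2.2 j k)

/-- A set of three elements has five partitions; transitivity rules out exactly two of the three
pairs being connected. -/
theorem Pattern.exists_isRooted {t : Fin 3 → V} {H : SimpleGraph V} (h1 : H.IsAcyclic)
    (h2 : ∀ v, ∃ j, H.Reachable v (t j)) : ∃ p : Pattern, IsRooted t p.rep H := by
  suffices ∃ p : Pattern, ∀ j k, H.Reachable (t j) (t k) ↔ p.rep j = p.rep k by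
    obtain ⟨p, hp⟩ := this
    exact ⟨p, h1, h2, hp⟩
  simp only [forall_fin_three_iff (r := fun j k => H.Reachable (t j) (t k))
      ⟨fun _ => Reachable.refl _, Reachable.symm, Reachable.trans⟩]
  by_cases h01 : H.Reachable (t 0) (t 1) <;> by_cases h02 : H.Reachable (t 0) (t 2)
  · have h12 := h01.symm.trans h02
    exact ⟨.tree, by simp [Pattern.rep, h01, h02, h12]⟩
  · have h12 : ¬ H.Reachable (t 1) (t 2) := fun h => h02 (h01.trans h)
    exact ⟨.right, by simp [Pattern.rep, h01, h02, h12]⟩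
  · have h12 : ¬ H.Reachable (t 1) (t 2) := fun h => h01 (h02.trans h.symm)
    exact ⟨.up, by simp [Pattern.rep, h01, h02, h12]⟩
  · by_cases h12 : H.Reachable (t 1) (t 2)
    · exact ⟨.left, by simp [Pattern.rep, h01, h02, h12]⟩
    · exact ⟨.sep, by simp [Pattern.rep, h01, h02, h12]⟩

end Types

/-! ### The five generating functions in terms of patterns. -/

section GenPattern

variable {K : Type*} [CommRing K] (a b c : K)

/-- The generating function of the spanning forests with a given pattern. -/
noncomputable def genPattern (n : ℕ) (p : Pattern) : K :=
  genFun (schreierGraph n) (edgeWeight a b c n) (IsRooted (corner n) p.rep)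

theorem genT_eq (n : ℕ) : genT a b c n = genPattern a b c n .tree := by
  refine genFun_congr (fun _ _ => rfl) fun H _ => ?_
  constructor
  · intro h
    exact ⟨h.isAcyclic, fun v => ⟨0, h.connected v _⟩,
      fun j k => iff_of_true (h.connected _ _) (by fin_cases j <;> fin_cases k <;> rfl)⟩
  · rintro ⟨h1, h2, h3⟩
    refine ⟨⟨fun u v => ?_⟩, h1⟩
    obtain ⟨j, hj⟩ := h2 u
    obtain ⟨k, hk⟩ := h2 v
    exact (hj.trans ((h3 j k).2 (by fin_cases j <;> fin_cases k <;> rfl))).trans hk.symm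

theorem genU_eq (n : ℕ) : genU a b c n = genPattern a b c n .up := by
  refine genFun_congr (fun _ _ => rfl) fun H _ => ?_
  rw [isRooted_iff_isForest_fin_three,
    show Fintype.card (Set.range Pattern.up.rep) = 2 by decide]
  change IsForest 2 H ∧ H.Reachable (corner n 0) (corner n 2) ∧
    ¬ H.Reachable (corner n 0) (corner n 1) ↔ _
  -- The definition mentions two of the three pairs; transitivity settles the third.
  have : H.Reachable (corner n 0) (corner n 2) → H.Reachable (corner n 1) (corner n 2) →
    H.Reachable (corner n 0) (corner n 1) := fun h h' => h.trans h'.symm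
  simp only [Pattern.rep, Matrix.cons_val, Fin.reduceEq, iff_false, iff_true]
  tauto

theorem genR_eq (n : ℕ) : genR a b c n = genPattern a b c n .right := by
  refine genFun_congr (fun _ _ => rfl) fun H _ => ?_
  rw [isRooted_iff_isForest_fin_three,
    show Fintype.card (Set.range Pattern.right.rep) = 2 by decide]
  change IsForest 2 H ∧ H.Reachable (corner n 0) (corner n 1) ∧
    ¬ H.Reachable (corner n 0) (corner n 2) ↔ _
  have : H.Reachable (corner n 0) (corner n 1) → H.Reachable (corner n 1) (corner n 2) →
    H.Reachable (corner n 0) (corner n 2) := Reachable.trans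
  simp only [Pattern.rep, Matrix.cons_val, Fin.reduceEq, iff_false, iff_true]
  tauto

theorem genL_eq (n : ℕ) : genL a b c n = genPattern a b c n .left := by
  refine genFun_congr (fun _ _ => rfl) fun H _ => ?_
  rw [isRooted_iff_isForest_fin_three,
    show Fintype.card (Set.range Pattern.left.rep) = 2 by decide]
  change IsForest 2 H ∧ H.Reachable (corner n 1) (corner n 2) ∧
    ¬ H.Reachable (corner n 1) (corner n 0) ↔ _
  have h1 : H.Reachable (corner n 1) (corner n 0) ↔ H.Reachable (corner n 0) (corner n 1) :=
    reachable_comm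
  have h2 : H.Reachable (corner n 0) (corner n 2) → H.Reachable (corner n 1) (corner n 2) →
    H.Reachable (corner n 0) (corner n 1) := fun h h' => h.trans h'.symm
  simp only [Pattern.rep, Matrix.cons_val, Fin.reduceEq, iff_false, iff_true]
  tauto

theorem genQ_eq (n : ℕ) : genQ a b c n = genPattern a b c n .sep := by
  refine genFun_congr (fun _ _ => rfl) fun H _ => ?_
  rw [isRooted_iff_isForest_fin_three,
    show Fintype.card (Set.range Pattern.sep.rep) = 3 by decide]
  simp only [Pattern.rep, Matrix.cons_val, Fin.reduceEq, iff_false]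
  exact Iff.rfl

end GenPattern

/-! ### The action seen from the last letter. -/

section SelfSimilar

/-- The words of length `n + 1` by their last letter. -/
def snoc (n : ℕ) : Fin 3 × Word n ≃ Word (n + 1) := Fin.snocEquiv fun _ => Fin 3

theorem snoc_apply (n : ℕ) (x : Fin 3) (w : Word n) :
    snoc n (x, w) = (Fin.snoc w x : Fin (n + 1) → Fin 3) := rfl

theorem act_corner (s : Gen) (n : ℕ) : act s n (corner n (fixedLetter s)) =
    corner n (fixedLetter s) := by
  induction n with
  | zero => rfl
  | succ n ih =>
    have : Fin.tail (corner (n + 1) (fixedLetter s)) = corner n (fixedLetter s) := rfl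
    have h : rootPerm s (fixedLetter s) = fixedLetter s := by cases s <;> rfl
    have h' : corner (n + 1) (fixedLetter s) 0 = fixedLetter s := rfl
    rw [act, this, if_pos h', ih, h', h]
    funext i
    refine Fin.cases ?_ (fun i => ?_) i <;> simp [corner]

theorem act_cons (s : Gen) (n : ℕ) (y : Fin 3) (v : Word n) :
    act s (n + 1) (Fin.cons y v : Fin (n + 1) → Fin 3) =
      (Fin.cons (rootPerm s y) (if y = fixedLetter s then act s n v else v) :
        Fin (n + 1) → Fin 3) := by
  simp only [act, Fin.cons_zero, Fin.tail_cons]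

open Classical in
-- The generator passes unchanged over an initial run of `fixedLetter s` and acts on the first other
-- letter. It gets to the last letter only if the run fills all of `w`.
theorem act_snoc (s : Gen) (n : ℕ) (x : Fin 3) (w : Word n) :
    act s (n + 1) (snoc n (x, w)) =
      if w = corner n (fixedLetter s) then snoc n (rootPerm s x, w)
      else snoc n (x, act s n w) := by
  induction n with
  | zero =>
    rw [if_pos (Subsingleton.elim _ _)]
    funext i
    obtain rfl : i = 0 := Fin.fin_one_eq_zero i
    simp [act, snoc_apply, Fin.snoc]
  | succ n ih =>
    obtain ⟨y, v, rfl⟩ : ∃ y v, w = (Fin.cons y v : Fin (n + 1) → Fin 3) :=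
      ⟨_, _, (Fin.cons_self_tail w).symm⟩
    have hsn : ∀ (z y : Fin 3) (v : Word n), snoc (n + 1) (z, (Fin.cons y v : Fin (n + 1) → Fin 3))
        = (Fin.cons y (snoc n (z, v)) : Fin (n + 2) → Fin 3) := by
      intro z y v
      simp only [snoc_apply]
      exact (Fin.cons_snoc_eq_snoc_cons (β := Fin 3) y v z).symm
    have hc : (Fin.cons y v : Fin (n + 1) → Fin 3) = corner (n + 1) (fixedLetter s) ↔
        y = fixedLetter s ∧ v = corner n (fixedLetter s) := by
      constructor
      · intro h
        exact ⟨by simpa [corner] using congrFun h 0,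
          funext fun i => by simpa [corner] using congrFun h i.succ⟩
      · rintro ⟨rfl, rfl⟩
        funext i
        refine Fin.cases ?_ (fun i => ?_) i <;> simp [corner]
    have hr : rootPerm s (fixedLetter s) = fixedLetter s := by cases s <;> rfl
    rw [hsn, act_cons, act_cons]
    by_cases hy : y = fixedLetter s
    · subst hy
      simp only [ih, hc, if_true, true_and]
      split_ifs with hv
      · rw [hsn, hr]
      · rw [hsn]
    · simp only [hy, hc, if_false, false_and]
      rw [hsn]

end SelfSimilar

/-! ### Decomposition of `Σ_{n+1}` into three copies and three bridges. -/

section Recursion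

/-- The ends of the edge with label `s` that joins two of the three copies of `Σ_n` in `Σ_{n+1}`:
the copies are numbered by the last letter, and `(i, j)` stands for the outmost vertex `j` of the
copy `i`. -/
def bridge : Gen → (Fin 3 × Fin 3) × (Fin 3 × Fin 3)
  | .a => ((0, 2), (1, 2))
  | .b => ((0, 1), (2, 1))
  | .c => ((1, 0), (2, 0))

/-- The outmost vertices of the three copies of `Σ_n` in `Σ_{n+1}`. -/
def innerCorner (n : ℕ) (x : Fin 3 × Fin 3) : Word (n + 1) := snoc n (x.1, corner n x.2)

theorem act_innerCorner (n : ℕ) (s : Gen) :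
    act s (n + 1) (innerCorner n (bridge s).1) = innerCorner n (bridge s).2 := by
  have h : (bridge s).1.2 = fixedLetter s := by cases s <;> rfl
  have h' : (bridge s).2 = (rootPerm s (bridge s).1.1, (bridge s).1.2) := by cases s <;> rfl
  rw [innerCorner, act_snoc, if_pos (by rw [h]), h', innerCorner]

theorem innerCorner_ne {n : ℕ} {x y : Fin 3 × Fin 3} (h : x.1 ≠ y.1) :
    innerCorner n x ≠ innerCorner n y := by
  intro h'
  exact h (Prod.mk.inj ((snoc n).injective h')).1

theorem innerCorner_bridge_ne (n : ℕ) (s : Gen) :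
    innerCorner n (bridge s).1 ≠ innerCorner n (bridge s).2 :=
  innerCorner_ne (by cases s <;> decide)

theorem addEdges_adj {V ι : Type*} {t : ι → V} (l : List (ι × ι)) :
    ∀ {H : SimpleGraph V} {u v : V}, (addEdges t H l).Adj u v ↔
      H.Adj u v ∨ ∃ x ∈ l, (edge (t x.1) (t x.2)).Adj u v := by
  induction l with
  | nil => simp [addEdges]
  | cons x l ih =>
    intro H u v
    simp only [addEdges, ih, sup_adj, List.mem_cons, exists_eq_or_imp, or_assoc]

theorem schreierGraph_succ (n : ℕ) :
    schreierGraph (n + 1) = addEdges (innerCorner n) (copies (snoc n) fun _ => schreierGraph n)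
      [bridge .a, bridge .b, bridge .c] := by
  ext x y
  rw [addEdges_adj]
  have hb : (∃ z ∈ [bridge .a, bridge .b, bridge .c],
      (edge (innerCorner n z.1) (innerCorner n z.2)).Adj x y) ↔
      ∃ s, (edge (innerCorner n (bridge s).1) (innerCorner n (bridge s).2)).Adj x y := by
    constructor
    · rintro ⟨z, hz, h⟩
      simp only [List.mem_cons, List.not_mem_nil, or_false] at hz
      rcases hz with rfl | rfl | rfl
      exacts [⟨_, h⟩, ⟨_, h⟩, ⟨_, h⟩]
    · rintro ⟨s, h⟩
      exact ⟨bridge s, by cases s <;> simp, h⟩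
  rw [hb]
  obtain ⟨⟨i, u⟩, rfl⟩ := (snoc n).surjective x
  obtain ⟨⟨j, v⟩, rfl⟩ := (snoc n).surjective y
  rw [copies_adj]
  constructor
  · rintro ⟨hne, s, hs⟩
    rw [act_snoc] at hs
    split_ifs at hs with hu
    · right
      refine ⟨s, (adj_edge _ _).2 ⟨?_, hne⟩⟩
      subst hu
      obtain ⟨rfl, rfl⟩ := Prod.mk.inj ((snoc n).injective hs)
      -- Loops are excluded, so `i` is one of the two letters swapped by `s`, that is, one of the
      -- two ends of its bridge.
      have hi : rootPerm s i ≠ i := fun h => hne (by rw [h])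
      have key : ∀ (s : Gen) (i : Fin 3), rootPerm s i ≠ i →
          ((bridge s).1 = (i, fixedLetter s) ∧ (bridge s).2 = (rootPerm s i, fixedLetter s)) ∨
          ((bridge s).2 = (i, fixedLetter s) ∧ (bridge s).1 = (rootPerm s i, fixedLetter s)) := by
        decide
      rw [Sym2.eq_iff]
      rcases key s i hi with ⟨h1, h2⟩ | ⟨h1, h2⟩
      · exact Or.inl (by rw [h1, h2]; exact ⟨rfl, rfl⟩)
      · exact Or.inr (by rw [h1, h2]; exact ⟨rfl, rfl⟩)
    · left
      obtain ⟨rfl, rfl⟩ := Prod.mk.inj ((snoc n).injective hs)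
      exact ⟨rfl, fun h => hne (by rw [← h]), s, rfl⟩
  · rintro (⟨rfl, hne, s, rfl⟩ | ⟨s, h⟩)
    · refine ⟨fun h => hne (Prod.mk.inj ((snoc n).injective h)).2, s, ?_⟩
      rw [act_snoc, if_neg]
      rintro rfl
      exact hne (act_corner s n).symm
    · obtain ⟨h, hne⟩ := (adj_edge _ _).1 h
      refine ⟨hne, s, ?_⟩
      rcases Sym2.eq_iff.1 h with ⟨h1, h2⟩ | ⟨h1, h2⟩
      · rw [← h1, ← h2, act_innerCorner]
      · rw [← h1, ← h2, ← act_innerCorner, act_act]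

variable {K : Type*} [CommRing K] (a b c : K)

theorem edgeWeight_bridge (n : ℕ) (s : Gen) :
    edgeWeight a b c (n + 1) s(innerCorner n (bridge s).1, innerCorner n (bridge s).2) =
      labelWeight a b c s := by
  rw [← act_innerCorner]
  refine edgeWeight_eq a b c _ s _ ?_
  rw [act_innerCorner]
  exact (innerCorner_bridge_ne n s).symm

/-- The ends of an edge labelled `s` are not the outmost vertex fixed by `s`, so appending a letter
keeps the label. -/
theorem edgeWeight_snoc (n : ℕ) (i : Fin 3) (x : Sym2 (Word n))
    (hx : x ∈ (schreierGraph n).edgeSet) :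
    edgeWeight a b c (n + 1) (x.map fun v => snoc n (i, v)) = edgeWeight a b c n x := by
  induction x with
  | h u v =>
    obtain ⟨hne, s, hs⟩ : u ≠ v ∧ ∃ s, act s n u = v := hx
    subst hs
    have hu : u ≠ corner n (fixedLetter s) := by
      rintro rfl
      exact hne (act_corner s n).symm
    have h : act s (n + 1) (snoc n (i, u)) = snoc n (i, act s n u) := by rw [act_snoc, if_neg hu]
    rw [edgeWeight_eq a b c n s u hne.symm, Sym2.map_mk, ← h]
    refine edgeWeight_eq a b c _ s _ ?_
    rw [h]
    exact fun h => hne (Prod.mk.inj ((snoc n).injective h)).2.symm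

/-- Whether three forests with patterns `p`, joined by the listed edges, form a forest with
pattern `q`. -/
abbrev Joins (q : Pattern) (l : List ((Fin 3 × Fin 3) × (Fin 3 × Fin 3)))
    (p : Fin 3 → Pattern) : Prop :=
  Outcome (fun k : Fin 3 => (k, k)) q.rep (fun x : Fin 3 × Fin 3 => (x.1, (p x.1).rep x.2)) l

/-- The contribution to `genPattern` at level `n + 1` of the forests that contain the listed
bridges, without the weight of these bridges. -/
noncomputable def genJoin (n : ℕ) (q : Pattern)
    (l : List ((Fin 3 × Fin 3) × (Fin 3 × Fin 3))) : K :=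
  ∑ p : Fin 3 → Pattern with Joins q l p, ∏ i, genPattern a b c n (p i)

theorem copies_not_adj_innerCorner (n : ℕ) {H : Fin 3 → SimpleGraph (Word n)}
    {x y : Fin 3 × Fin 3} (h : x.1 ≠ y.1) :
    ¬ (copies (snoc n) H).Adj (innerCorner n x) (innerCorner n y) := by
  rw [innerCorner, innerCorner, copies_adj]
  exact fun h' => h h'.1

/-- Different bridges join different pairs of copies. Only the copy numbers are compared, since at
level 0 the outmost vertices of a copy coincide. -/
theorem bridge_ne {n : ℕ} {s t : Gen} (h : s ≠ t) :
    s(innerCorner n (bridge s).1, innerCorner n (bridge s).2) ≠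
      s(innerCorner n (bridge t).1, innerCorner n (bridge t).2) := by
  intro h'
  have key : ∀ s t : Gen, s ≠ t → s((bridge s).1.1, (bridge s).2.1) ≠
      s((bridge t).1.1, (bridge t).2.1) := by decide
  refine key s t h ?_
  have := congrArg (Sym2.map fun w => ((snoc n).symm w).1) h'
  simpa [innerCorner] using this

theorem genFun_addEdges (n : ℕ) (q : Pattern) (l : List Gen) (hl : l.Nodup) :
    genFun (copies (snoc n) fun _ => schreierGraph n) (edgeWeight a b c (n + 1))
      (fun H => IsRooted (corner (n + 1)) q.rep (addEdges (innerCorner n) H (l.map bridge))) =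
      genJoin a b c n q (l.map bridge) := by
  -- The outmost vertex `k` of the large graph is the outmost vertex `k` of the copy `k`.
  have hcorner : corner (n + 1) = innerCorner n ∘ fun k : Fin 3 => (k, k) := by
    funext k i
    refine Fin.lastCases ?_ (fun i => ?_) i <;> simp [corner, innerCorner, snoc_apply]
  have hne : ∀ s, (bridge s).1.1 ≠ (bridge s).2.1 := by decide
  rw [genJoin, genFun_copies (snoc n) (schreierGraph n) (edgeWeight a b c (n + 1))
    (edgeWeight a b c n) (edgeWeight_snoc a b c n) _
    (fun p : Pattern => IsRooted (corner n) p.rep) (Joins q (l.map bridge))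
    (fun H p q => Pattern.eq_of_isRooted)]
  · congr!
  · intro H _
    have hiff : ∀ p : Fin 3 → Pattern, (∀ i, IsRooted (corner n) (p i).rep (H i)) →
        (IsRooted (corner (n + 1)) q.rep
          (addEdges (innerCorner n) (copies (snoc n) H) (l.map bridge)) ↔
        Joins q (l.map bridge) p) := by
      intro p hp
      rw [hcorner]
      refine isRooted_addEdges_iff _ _ _ (IsRooted.copies hp) ?_ ?_ ?_
      · simp only [List.mem_map, forall_exists_index, and_imp, forall_apply_eq_imp_iff₂]
        exact fun s _ => innerCorner_bridge_ne n s
      · simp only [List.mem_map, forall_exists_index, and_imp, forall_apply_eq_imp_iff₂]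
        exact fun s _ => copies_not_adj_innerCorner n (hne s)
      · rw [List.pairwise_map]
        exact hl.imp fun h => bridge_ne h
    constructor
    · intro h
      have h' : ∀ i, ∃ p : Pattern, IsRooted (corner n) p.rep (H i) := by
        intro i
        rw [hcorner] at h
        obtain ⟨h1, h2⟩ := isAcyclic_and_rooted_of_copies h i
        exact Pattern.exists_isRooted h1 h2
      choose p hp using h'
      exact ⟨p, (hiff p hp).1 h, hp⟩
    · rintro ⟨p, h, hp⟩
      exact (hiff p hp).2 h

theorem genPattern_succ (n : ℕ) (q : Pattern) :
    genPattern a b c (n + 1) q =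
      genJoin a b c n q [] + a * genJoin a b c n q [bridge .a] +
        b * genJoin a b c n q [bridge .b] + c * genJoin a b c n q [bridge .c] +
        a * b * genJoin a b c n q [bridge .a, bridge .b] +
        a * c * genJoin a b c n q [bridge .a, bridge .c] +
        b * c * genJoin a b c n q [bridge .b, bridge .c] +
        a * b * c * genJoin a b c n q [bridge .a, bridge .b, bridge .c] := by
  set D := copies (snoc n) fun _ => schreierGraph n with hD
  have hne := innerCorner_bridge_ne n
  have hb : ∀ s, (bridge s).1.1 ≠ (bridge s).2.1 := by decide
  have hA : ¬ D.Adj (innerCorner n (bridge .a).1) (innerCorner n (bridge .a).2) :=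
    copies_not_adj_innerCorner n (hb _)
  have hB : ¬ (D ⊔ edge (innerCorner n (bridge .a).1) (innerCorner n (bridge .a).2)).Adj
      (innerCorner n (bridge .b).1) (innerCorner n (bridge .b).2) := by
    rw [sup_adj, adj_edge]
    exact not_or.2 ⟨copies_not_adj_innerCorner n (hb _), fun h => bridge_ne (by decide) h.1⟩
  have hC : ¬ (D ⊔ edge (innerCorner n (bridge .a).1) (innerCorner n (bridge .a).2) ⊔
      edge (innerCorner n (bridge .b).1) (innerCorner n (bridge .b).2)).Adj
      (innerCorner n (bridge .c).1) (innerCorner n (bridge .c).2) := by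
    rw [sup_adj, sup_adj, adj_edge, adj_edge]
    exact not_or.2 ⟨not_or.2 ⟨copies_not_adj_innerCorner n (hb _),
      fun h => bridge_ne (by decide) h.1⟩, fun h => bridge_ne (by decide) h.1⟩
  have key := fun l hl => genFun_addEdges a b c n q l hl
  rw [← hD] at key
  have h0 := key [] (by decide)
  have h1 := key [.a] (by decide)
  have h2 := key [.b] (by decide)
  have h3 := key [.c] (by decide)
  have h4 := key [.a, .b] (by decide)
  have h5 := key [.a, .c] (by decide)
  have h6 := key [.b, .c] (by decide)
  have h7 := key [.a, .b, .c] (by decide)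
  simp only [List.map_cons, List.map_nil, addEdges] at h0 h1 h2 h3 h4 h5 h6 h7
  rw [genPattern, schreierGraph_succ, ← hD]
  simp only [addEdges]
  -- The outermost edge `c` is split off first, so the chosen bridges reappear inside the predicate
  -- in the order a, b, c used by `addEdges`.
  rw [genFun_sup_edge _ _ (hne .c) hC, genFun_sup_edge _ _ (hne .b) hB,
    genFun_sup_edge _ _ (hne .a) hA, genFun_sup_edge _ _ (hne .b) hB,
    genFun_sup_edge _ _ (hne .a) hA, genFun_sup_edge _ _ (hne .a) hA,
    genFun_sup_edge _ _ (hne .a) hA, edgeWeight_bridge, edgeWeight_bridge, edgeWeight_bridge,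
    h0, h1, h2, h3, h4, h5, h6, h7]
  simp only [labelWeight]
  ring

end Recursion

/-! ### Evaluation of the finite sums. -/

section Evaluation

variable {K : Type*} [CommRing K] (a b c : K)

/-- At level 0 the three outmost vertices coincide, so only the pattern with all of them connected
occurs. -/
theorem genPattern_zero (q : Pattern) :
    genPattern a b c 0 q = if q = .tree then 1 else 0 := by
  classical
  have key : ∀ H : SimpleGraph (Word 0), IsRooted (corner 0) q.rep H ↔ q = .tree := by
    intro H
    have hr : ∀ u v, H.Reachable u v := fun u v => by rw [Subsingleton.elim u v]
    have hq : (∀ j k, q.rep j = q.rep k) ↔ q = .tree := by revert q; decide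
    rw [← hq]
    exact ⟨fun h j k => (h.2.2 j k).1 (hr _ _), fun h => ⟨IsAcyclic.of_subsingleton,
      fun v => ⟨0, hr _ _⟩, fun j k => iff_of_true (hr _ _) (h j k)⟩⟩
  have hbot : ∀ H : SimpleGraph (Word 0), H = ⊥ := fun H => Subsingleton.elim _ _
  have hprod : ∀ H : SimpleGraph (Word 0),
      ∏ x ∈ H.edgeFinset, edgeWeight a b c 0 x = 1 := by
    refine fun H => Finset.prod_eq_one fun x hx => ?_
    induction x with
    | h u v => exact absurd (Subsingleton.elim u v) (mem_edgeFinset.1 hx).ne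
  rw [genPattern, genFun]
  simp only [key]
  split_ifs with hq
  · rw [Finset.sum_eq_single_of_mem ⊥ (by simp [hq]) fun H _ h => absurd (hbot H) h]
    exact hprod ⊥
  · simp [hq]

theorem genJoin_eq (n : ℕ) (q : Pattern) (l : List ((Fin 3 × Fin 3) × (Fin 3 × Fin 3))) :
    genJoin a b c n q l = ∑ x : Pattern, ∑ y : Pattern, ∑ z : Pattern,
      if Joins q l ![x, y, z] then
        genPattern a b c n x * genPattern a b c n y * genPattern a b c n z else 0 := by
  rw [genJoin, Finset.sum_filter, ← Fintype.sum_prod_type', ← Fintype.sum_prod_type']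
  refine Fintype.sum_equiv ⟨fun p => ((p 0, p 1), p 2), fun x => ![x.1.1, x.1.2, x.2], ?_, ?_⟩
    _ _ ?_
  · intro p
    funext i
    fin_cases i <;> rfl
  · intro x
    rfl
  · intro p
    have : ![p 0, p 1, p 2] = p := by
      funext i
      fin_cases i <;> rfl
    change _ = if Joins q l ![p 0, p 1, p 2] then _ else 0
    rw [this, Fin.prod_univ_three]
    rfl

theorem sum_pattern (f : Pattern → K) :
    ∑ x, f x = f .tree + f .up + f .right + f .left + f .sep := by
  change ∑ x ∈ {Pattern.tree, .up, .right, .left, .sep}, f x = _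
  simp [add_assoc]

/-- Two bridges require three trees. With all three bridges, one copy must be a 2-forest separating
its two bridge ends; two patterns do this in each copy, and each of U, R, L arises twice. -/
theorem genPattern_succ_tree (n : ℕ) {T U R L Q : K} (hT : genPattern a b c n .tree = T)
    (hU : genPattern a b c n .up = U) (hR : genPattern a b c n .right = R)
    (hL : genPattern a b c n .left = L) (hQ : genPattern a b c n .sep = Q) :
    genPattern a b c (n + 1) .tree =
      T ^ 3 * (a * b + a * c + b * c) + 2 * a * b * c * T ^ 2 * (U + R + L) := by
  rw [genPattern_succ]
  -- Every condition `Joins` is now about explicit patterns and bridges and is decided by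
  -- computation.
  simp (decide := true) only [genJoin_eq, sum_pattern, if_true, if_false, zero_add, add_zero,
    hT, hU, hR, hL, hQ]
  ring

theorem genPattern_succ_up (n : ℕ) {T U R L Q : K} (hT : genPattern a b c n .tree = T)
    (hU : genPattern a b c n .up = U) (hR : genPattern a b c n .right = R)
    (hL : genPattern a b c n .left = L) (hQ : genPattern a b c n .sep = Q) :
    genPattern a b c (n + 1) .up =
      b * T ^ 3
          + T ^ 2 * ((a * b + a * c + b * c) * U + 2 * b * (a * R + c * L))
          + a * b * c * T * (3 * R * L + U * (L + R + 2 * U))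
          + a * b * c * T ^ 2 * Q := by
  rw [genPattern_succ]
  simp (decide := true) only [genJoin_eq, sum_pattern, if_true, if_false, zero_add, add_zero,
    hT, hU, hR, hL, hQ]
  ring

theorem genPattern_succ_right (n : ℕ) {T U R L Q : K} (hT : genPattern a b c n .tree = T)
    (hU : genPattern a b c n .up = U) (hR : genPattern a b c n .right = R)
    (hL : genPattern a b c n .left = L) (hQ : genPattern a b c n .sep = Q) :
    genPattern a b c (n + 1) .right =
      a * T ^ 3
          + T ^ 2 * ((a * b + a * c + b * c) * R + 2 * a * (b * U + c * L))
          + a * b * c * T * (3 * U * L + R * (L + U + 2 * R))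
          + a * b * c * T ^ 2 * Q := by
  rw [genPattern_succ]
  simp (decide := true) only [genJoin_eq, sum_pattern, if_true, if_false, zero_add, add_zero,
    hT, hU, hR, hL, hQ]
  ring

theorem genPattern_succ_left (n : ℕ) {T U R L Q : K} (hT : genPattern a b c n .tree = T)
    (hU : genPattern a b c n .up = U) (hR : genPattern a b c n .right = R)
    (hL : genPattern a b c n .left = L) (hQ : genPattern a b c n .sep = Q) :
    genPattern a b c (n + 1) .left =
      c * T ^ 3
          + T ^ 2 * ((a * b + a * c + b * c) * L + 2 * c * (a * R + b * U))
          + a * b * c * T * (3 * R * U + L * (U + R + 2 * L))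
          + a * b * c * T ^ 2 * Q := by
  rw [genPattern_succ]
  simp (decide := true) only [genJoin_eq, sum_pattern, if_true, if_false, zero_add, add_zero,
    hT, hU, hR, hL, hQ]
  ring

/-- With `m` bridges the three parts must have `m + 3` components in all, which explains which
monomials accompany each weight. -/
theorem genPattern_succ_sep (n : ℕ) {T U R L Q : K} (hT : genPattern a b c n .tree = T)
    (hU : genPattern a b c n .up = U) (hR : genPattern a b c n .right = R)
    (hL : genPattern a b c n .left = L) (hQ : genPattern a b c n .sep = Q) :
    genPattern a b c (n + 1) .sep =
      4 * a * b * c * T * Q * (U + R + L)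
          + T ^ 2 * ((2 * b + a + c) * U + (2 * a + b + c) * R + (2 * c + a + b) * L)
          + T ^ 2 * Q * (a * b + a * c + b * c) + T ^ 3
          + 2 * a * b * c * (U ^ 2 * (R + L) + R ^ 2 * (U + L)
              + L ^ 2 * (U + R) + U * R * L)
          + 2 * T * (U * R * (a * c + b * c + 2 * a * b)
              + U * L * (a * b + a * c + 2 * b * c)
              + R * L * (a * b + b * c + 2 * a * c)
              + b * U ^ 2 * (a + c) + a * R ^ 2 * (b + c) + c * L ^ 2 * (a + b)) := by
  rw [genPattern_succ]
  simp (decide := true) only [genJoin_eq, sum_pattern, if_true, if_false, zero_add, add_zero,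
    hT, hU, hR, hL, hQ]
  ring

end Evaluation

end Hanoi

theorem mainTheorem9 {K : Type*} [CommRing K] (a b c : K) (T U R L Q : ℕ → K)
    (hT : ∀ n, T n = Hanoi.genT a b c n)
    (hU : ∀ n, U n = Hanoi.genU a b c n)
    (hR : ∀ n, R n = Hanoi.genR a b c n)
    (hL : ∀ n, L n = Hanoi.genL a b c n)
    (hQ : ∀ n, Q n = Hanoi.genQ a b c n) :
    (∀ n : ℕ, 1 ≤ n →
      T (n + 1) = T n ^ 3 * (a * b + a * c + b * c)
          + 2 * a * b * c * T n ^ 2 * (U n + R n + L n) ∧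
      U (n + 1) = b * T n ^ 3
          + T n ^ 2 * ((a * b + a * c + b * c) * U n + 2 * b * (a * R n + c * L n))
          + a * b * c * T n * (3 * R n * L n + U n * (L n + R n + 2 * U n))
          + a * b * c * T n ^ 2 * Q n ∧
      R (n + 1) = a * T n ^ 3
          + T n ^ 2 * ((a * b + a * c + b * c) * R n + 2 * a * (b * U n + c * L n))
          + a * b * c * T n * (3 * U n * L n + R n * (L n + U n + 2 * R n))
          + a * b * c * T n ^ 2 * Q n ∧
      L (n + 1) = c * T n ^ 3
          + T n ^ 2 * ((a * b + a * c + b * c) * L n + 2 * c * (a * R n + b * U n))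
          + a * b * c * T n * (3 * R n * U n + L n * (U n + R n + 2 * L n))
          + a * b * c * T n ^ 2 * Q n ∧
      Q (n + 1) = 4 * a * b * c * T n * Q n * (U n + R n + L n)
          + T n ^ 2 * ((2 * b + a + c) * U n + (2 * a + b + c) * R n + (2 * c + a + b) * L n)
          + T n ^ 2 * Q n * (a * b + a * c + b * c) + T n ^ 3
          + 2 * a * b * c * (U n ^ 2 * (R n + L n) + R n ^ 2 * (U n + L n)
              + L n ^ 2 * (U n + R n) + U n * R n * L n)
          + 2 * T n * (U n * R n * (a * c + b * c + 2 * a * b)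
              + U n * L n * (a * b + a * c + 2 * b * c)
              + R n * L n * (a * b + b * c + 2 * a * c)
              + b * U n ^ 2 * (a + c) + a * R n ^ 2 * (b + c) + c * L n ^ 2 * (a + b))) ∧
    T 1 = a * b + a * c + b * c ∧ U 1 = b ∧ R 1 = a ∧ L 1 = c ∧ Q 1 = 1 := by
  simp only [Hanoi.genT_eq] at hT
  simp only [Hanoi.genU_eq] at hU
  simp only [Hanoi.genR_eq] at hR
  simp only [Hanoi.genL_eq] at hL
  simp only [Hanoi.genQ_eq] at hQ
  have h1 := fun n => Hanoi.genPattern_succ_tree a b c n (hT n).symm (hU n).symm (hR n).symm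
    (hL n).symm (hQ n).symm
  have h2 := fun n => Hanoi.genPattern_succ_up a b c n (hT n).symm (hU n).symm (hR n).symm
    (hL n).symm (hQ n).symm
  have h3 := fun n => Hanoi.genPattern_succ_right a b c n (hT n).symm (hU n).symm (hR n).symm
    (hL n).symm (hQ n).symm
  have h4 := fun n => Hanoi.genPattern_succ_left a b c n (hT n).symm (hU n).symm (hR n).symm
    (hL n).symm (hQ n).symm
  have h5 := fun n => Hanoi.genPattern_succ_sep a b c n (hT n).symm (hU n).symm (hR n).symm
    (hL n).symm (hQ n).symm
  simp only [← hT, ← hU, ← hR, ← hL, ← hQ] at h1 h2 h3 h4 h5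
  -- The recursion at 0 builds the triangle `Σ_1` from three single vertices, so these values
  -- determine those at level 1.
  have hT0 : T 0 = 1 := by rw [hT, Hanoi.genPattern_zero, if_pos rfl]
  have hU0 : U 0 = 0 := by rw [hU, Hanoi.genPattern_zero, if_neg (by decide)]
  have hR0 : R 0 = 0 := by rw [hR, Hanoi.genPattern_zero, if_neg (by decide)]
  have hL0 : L 0 = 0 := by rw [hL, Hanoi.genPattern_zero, if_neg (by decide)]
  have hQ0 : Q 0 = 0 := by rw [hQ, Hanoi.genPattern_zero, if_neg (by decide)]
  refine ⟨fun n _ => ⟨h1 n, h2 n, h3 n, h4 n, h5 n⟩, ?_, ?_, ?_, ?_, ?_⟩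
  · simpa [hT0, hU0, hR0, hL0, hQ0] using h1 0
  · simpa [hT0, hU0, hR0, hL0, hQ0] using h2 0
  · simpa [hT0, hU0, hR0, hL0, hQ0] using h3 0
  · simpa [hT0, hU0, hR0, hL0, hQ0] using h4 0
  · simpa [hT0, hU0, hR0, hL0, hQ0] using h5 0
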